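/- Let $F$ be a perfect field and let $k/F$ be an arbitrary field extension. Then: (1) $k/F$ is separable, in the sense that every intermediate field $F\subseteq K'\subseteq k$ that is finitely generated as a field extension of $F$ has a separating transcendence basis over $F$, i.e. a finite transcendence basis $\{x_1,\dots,x_n\}\subseteq K'$ of $K'/F$ such that $K'$ is a separable algebraic extension of $F(x_1,\dots,x_n)$; (2) $k$ is formally smooth over $F$, i.e. for every $F$-algebra $A$ (commutative) and every ideal $I\subseteq A$ with $I^2=0$, each $F$-algebra homomorphism $k\to A/I$ lifts to an $F$-algebra homomorphism $k\to A$. -/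

import Mathlib

/-- `K/k` has a separating transcendence basis: a finite transcendence basis `s` such that `K` is
a separable algebraic extension of `k(s)`. -/
def HasSeparatingTranscendenceBasis (k K : Type*) [Field k] [Field K] [Algebra k K] : Prop :=
  ∃ s : Finset K, IsTranscendenceBasis k ((↑) : s → K) ∧
    Algebra.IsSeparable (IntermediateField.adjoin k (s : Set K)) K

/-- An arbitrary (not necessarily algebraic) field extension `K/k` is separable if every
subextension that is finitely generated as a field extension of `k` has a separating
transcendence basis. -/
def IsSeparableFieldExtension (k K : Type*) [Field k] [Field K] [Algebra k K] : Prop :=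
  ∀ K' : IntermediateField k K, K'.FG → HasSeparatingTranscendenceBasis k K'

/-! For finitely generated subextensions, both claims are known over a perfect field. Smoothness
passes to `k` because the criterion for `H¹ = 0` tests one polynomial at a time, and each involves
only finitely many elements of `k`. -/

open MvPolynomial in
/-- `H¹(L_{A/R})` vanishes iff, for the tautological presentation `R[X_a | a ∈ A] → A` with
kernel `I`, every element of `I` all of whose partial derivatives lie in `I` belongs to `I²`. -/
theorem Algebra.subsingleton_h1Cotangent_iff_mem_ker_sq (R A : Type*) [CommRing R] [CommRing A]
    [Algebra R A] :
    Subsingleton (Algebra.H1Cotangent R A) ↔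
      ∀ p : MvPolynomial A R, aeval (_root_.id : A → A) p = 0 →
        (∀ a, aeval (_root_.id : A → A) (pderiv a p) = 0) →
        p ∈ RingHom.ker (aeval (R := R) (_root_.id : A → A)) ^ 2 := by
  let P := Algebra.Generators.self R A
  have hcomplex (p : P.toExtension.ker) :
      P.toExtension.cotangentComplex (.mk p) = 0 ↔
        ∀ a, aeval (_root_.id : A → A) (pderiv a p.1) = 0 := by
    rw [← P.cotangentSpaceBasis.repr.map_eq_zero_iff, Finsupp.ext_iff]
    refine forall_congr' fun a ↦ ?_
    rw [Algebra.Extension.cotangentComplex_mk]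
    exact Eq.congr_left (P.cotangentSpaceBasis_repr_one_tmul p a)
  have hmk (p : P.toExtension.ker) : Algebra.Extension.Cotangent.mk p = 0 ↔
      p.1 ∈ RingHom.ker (aeval (R := R) (_root_.id : A → A)) ^ 2 :=
    (Algebra.Extension.Cotangent.ext_iff).trans (Ideal.toCotangent_eq_zero _ p)
  rw [Algebra.Extension.subsingleton_h1Cotangent, injective_iff_map_eq_zero]
  constructor
  · intro h p hp hd
    exact (hmk ⟨p, hp⟩).mp (h _ ((hcomplex ⟨p, hp⟩).mpr hd))
  · intro h x hx
    obtain ⟨p, rfl⟩ := Algebra.Extension.Cotangent.mk_surjective x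
    exact (hmk p).mpr (h p.1 p.2 ((hcomplex p).mp hx))

open MvPolynomial in
/-- A field extension is formally smooth if all its finitely generated subextensions are. -/
theorem Algebra.FormallySmooth.of_forall_intermediateField_fg {K L : Type*} [Field K] [Field L]
    [Algebra K L]
    (h : ∀ E : IntermediateField K L, E.FG → Algebra.FormallySmooth K E) :
    Algebra.FormallySmooth K L := by
  -- `Ω[L⁄K]` is an `L`-vector space, hence projective; only `H¹ = 0` remains.
  refine ⟨inferInstance, (subsingleton_h1Cotangent_iff_mem_ker_sq K L).mpr fun p hp hd ↦ ?_⟩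
  obtain ⟨s, q, rfl⟩ := exists_finset_rename p
  let E := IntermediateField.adjoin K (s : Set L)
  have : Algebra.FormallySmooth K E := h E ⟨s, rfl⟩
  let r : MvPolynomial E K :=
    rename (fun i : s ↦ (⟨i, IntermediateField.subset_adjoin K _ i.2⟩ : E)) q
  have hr : rename ((↑) : s → L) q = rename ((↑) : E → L) r := by
    rw [rename_rename]
    rfl
  have haeval (f : MvPolynomial E K) :
      aeval (_root_.id : L → L) (rename ((↑) : E → L) f) = (aeval (_root_.id : E → E) f : E) := by
    rw [aeval_rename]
    exact (comp_aeval_apply _ E.val f).symm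
  rw [hr] at hp hd ⊢
  -- Both conditions descend to `E` since `E → L` is injective.
  have hmem := (subsingleton_h1Cotangent_iff_mem_ker_sq K E).mp inferInstance r
    (by exact_mod_cast (haeval r).symm.trans hp) fun a ↦ by
      have := hd a
      rw [pderiv_rename Subtype.val_injective, haeval] at this
      exact_mod_cast this
  have hle : RingHom.ker (aeval (R := K) (_root_.id : E → E)) ≤
      (RingHom.ker (aeval (R := K) (_root_.id : L → L))).comap (rename ((↑) : E → L)) := fun f hf ↦ by
    rw [Ideal.mem_comap, RingHom.mem_ker, haeval, RingHom.mem_ker.mp hf, ZeroMemClass.coe_zero]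
  exact Ideal.le_comap_pow _ 2 (Ideal.pow_right_mono hle 2 hmem)

theorem mainTheorem5 {F k : Type*} [Field F] [PerfectField F] [Field k] [Algebra F k] :
    IsSeparableFieldExtension F k ∧ Algebra.FormallySmooth F k := by
  refine ⟨fun E hE ↦ ?_, .of_forall_intermediateField_fg fun E hE ↦ ?_⟩
  all_goals have := IntermediateField.essFiniteType_iff.mpr hE
  · exact exists_isTranscendenceBasis_and_isSeparable_of_perfectField F E
  · exact .of_perfectField
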